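/- Let $G_{16}$ be the graph with vertex set $\{0,1\}^{16}$ in which two vertices $u, v$ are adjacent if and only if they differ in exactly $8$ of the $16$ positions (that is, their Hamming distance is $d_H(u,v) = 8$). Then the chromatic number of $G_{16}$ satisfies $\chi(G_{16}) > 16$. -/

import Mathlib

/-- The graph `G_N` on the binary strings of length `N ≥ 1`: two strings are adjacent when they
differ in exactly half of the `N` positions. The condition `d_H(u, v) = N / 2` is written without
division, so for odd `N` there are no edges. -/
def halfDistGraph (N : ℕ) [NeZero N] : SimpleGraph (Fin N → Bool) where
  Adj u v := 2 * hammingDist u v = N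
  symm := ⟨fun u v h => by rw [hammingDist_comm]; exact h⟩
  loopless := ⟨fun u h => NeZero.ne N (by simpa using h.symm)⟩

/-! Suppose 16 colours suffice and let `f` be the indicator of one colour class. The rows of a
Hadamard matrix of order 16, with columns permuted and then translated, form a 16-clique, which the
class meets exactly once. Hence a Walsh coefficient of `f` at a nonempty `S` vanishes once `walsh S`
is trivial on some such matrix, leaving only sizes 0, 2 and 14 (`walshCoeff_colorIndic_eq_zero`).
Integrality of `f` makes the joint coefficients of pairs and their complements multiples of 4096,
with quotients all of one parity (`dvd_pairCoeff_iff`). Even quotients contradict inversion at a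
point; odd ones violate Parseval. -/

section Walsh

variable {ι : Type*}

/-- The sign `(-1)^b` of a bit. -/
def bitSign (b : Bool) : ℤ := if b then -1 else 1

lemma bitSign_xor (a b : Bool) : bitSign (xor a b) = bitSign a * bitSign b := by
  cases a <;> cases b <;> rfl

lemma bitSign_mul_self (a : Bool) : bitSign a * bitSign a = 1 := by
  cases a <;> rfl

/-- The Walsh function (character of the cube) attached to a set of coordinates. -/
def walsh (S : Finset ι) (x : ι → Bool) : ℤ := ∏ i ∈ S, bitSign (x i)

/-- Coordinatewise addition modulo two. -/
def bxor (x y : ι → Bool) : ι → Bool := fun i => xor (x i) (y i)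

lemma walsh_bxor (S : Finset ι) (x y : ι → Bool) :
    walsh S (bxor x y) = walsh S x * walsh S y := by
  simp only [walsh, bxor, bitSign_xor, Finset.prod_mul_distrib]

lemma walsh_mul_self (S : Finset ι) (x : ι → Bool) : walsh S x * walsh S x = 1 := by
  simp only [walsh, ← Finset.prod_mul_distrib, bitSign_mul_self, Finset.prod_const_one]

@[simp] lemma walsh_empty (x : ι → Bool) : walsh ∅ x = 1 := rfl

@[simp] lemma walsh_zero (S : Finset ι) : walsh S (fun _ => false) = 1 := by
  simp [walsh, bitSign]

lemma bxor_involutive (y : ι → Bool) : Function.Involutive fun x : ι → Bool => bxor x y := by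
  intro x; funext i; simp [bxor]

lemma sum_walsh_mul_walsh [Fintype ι] (x y : ι → Bool) :
    ∑ S : Finset ι, walsh S x * walsh S y = if x = y then 2 ^ Fintype.card ι else 0 := by
  have h : ∑ S : Finset ι, walsh S x * walsh S y
      = ∏ i, (1 + bitSign (x i) * bitSign (y i)) := by
    rw [Finset.prod_one_add, Finset.powerset_univ]
    simp only [walsh, Finset.prod_mul_distrib]
  rw [h]
  split_ifs with hxy
  · subst hxy
    simp [bitSign_mul_self]
  · obtain ⟨i, hi⟩ := Function.ne_iff.mp hxy
    refine Finset.prod_eq_zero (Finset.mem_univ i) ?_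
    revert hi
    cases x i <;> cases y i <;> simp [bitSign]

variable [DecidableEq ι]

/-- The indicator vector of a set of coordinates. -/
def indic (T : Finset ι) : ι → Bool := fun i => decide (i ∈ T)

lemma walsh_indic_comm (S T : Finset ι) : walsh S (indic T) = walsh T (indic S) := by
  simp only [walsh, indic, bitSign, decide_eq_true_eq, Finset.prod_ite_mem, Finset.inter_comm]

lemma walsh_indic_pair (S : Finset ι) {a b : ι} (h : a ≠ b) :
    walsh S (indic {a, b}) = (if a ∈ S then -1 else 1) * (if b ∈ S then -1 else 1) := by
  rw [walsh_indic_comm, walsh, Finset.prod_pair h]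
  simp [indic, bitSign]

variable [Fintype ι]

lemma sum_bxor (f : (ι → Bool) → ℤ) (y : ι → Bool) : ∑ x, f (bxor x y) = ∑ x, f x :=
  Equiv.sum_comp (bxor_involutive y).toPerm f

lemma sum_walsh_of_nonempty {S : Finset ι} (hS : S.Nonempty) : ∑ x, walsh S x = 0 := by
  obtain ⟨i, hi⟩ := hS
  have h := sum_bxor (walsh S) (indic {i})
  have hw : walsh S (indic {i}) = -1 := by
    rw [walsh_indic_comm]; simp [walsh, indic, bitSign, hi]
  simp only [walsh_bxor, hw, mul_neg, mul_one, Finset.sum_neg_distrib] at h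
  linarith

lemma walsh_compl_of_univ {x : ι → Bool} (hx : walsh Finset.univ x = 1) (S : Finset ι) :
    walsh Sᶜ x = walsh S x := by
  have h : walsh S x * walsh Sᶜ x = 1 := by
    rw [← hx]; exact Finset.prod_mul_prod_compl S _
  have h2 := walsh_mul_self S x
  calc walsh Sᶜ x = (walsh S x * walsh S x) * walsh Sᶜ x := by rw [h2, one_mul]
    _ = walsh S x := by rw [mul_assoc, h, mul_one]

/-- The unnormalised Walsh coefficient. -/
def walshCoeff (f : (ι → Bool) → ℤ) (S : Finset ι) : ℤ := ∑ x, f x * walsh S x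

lemma sum_walshCoeff_mul_walsh (f : (ι → Bool) → ℤ) (x : ι → Bool) :
    ∑ S, walshCoeff f S * walsh S x = 2 ^ Fintype.card ι * f x := by
  simp only [walshCoeff, Finset.sum_mul]
  rw [Finset.sum_comm]
  simp only [mul_assoc, ← Finset.mul_sum, sum_walsh_mul_walsh, mul_ite, mul_zero,
    Finset.sum_ite_eq', Finset.mem_univ, if_true]
  ring

lemma sum_walshCoeff_sq (f : (ι → Bool) → ℤ) :
    ∑ S, walshCoeff f S ^ 2 = 2 ^ Fintype.card ι * ∑ x, f x ^ 2 := by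
  have h : ∀ S, walshCoeff f S ^ 2 = ∑ x, f x * (walshCoeff f S * walsh S x) := by
    intro S
    rw [sq]
    nth_rewrite 2 [walshCoeff]
    rw [Finset.mul_sum]
    exact Finset.sum_congr rfl fun x _ => by ring
  simp only [h]
  rw [Finset.sum_comm, Finset.mul_sum]
  refine Finset.sum_congr rfl fun x _ => ?_
  rw [← Finset.mul_sum, sum_walshCoeff_mul_walsh]
  ring

/-- If all translates of the family `w` meet `f` with total weight one, then a Walsh function
trivial on `w` sees only the mean of `f`. -/
lemma card_mul_walshCoeff {κ : Type*} [Fintype κ] (f : (ι → Bool) → ℤ) (w : κ → ι → Bool)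
    (hf : ∀ x, ∑ u, f (bxor x (w u)) = 1) (S : Finset ι) (hS : ∀ u, walsh S (w u) = 1) :
    (Fintype.card κ : ℤ) * walshCoeff f S = ∑ x, walsh S x := by
  have h : ∀ u, walshCoeff f S = ∑ x, f (bxor x (w u)) * walsh S x := by
    intro u
    rw [walshCoeff, ← sum_bxor _ (w u)]
    simp only [walsh_bxor, hS u, mul_one]
  calc (Fintype.card κ : ℤ) * walshCoeff f S = ∑ _u : κ, walshCoeff f S := by simp
    _ = ∑ u, ∑ x, f (bxor x (w u)) * walsh S x := Finset.sum_congr rfl fun u _ => h u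
    _ = ∑ x, walsh S x := by
        rw [Finset.sum_comm]
        exact Finset.sum_congr rfl fun x _ => by rw [← Finset.sum_mul, hf, one_mul]

end Walsh

/-! ### Hadamard cliques and the support of the spectrum -/

section Clique

/-- The inner product modulo two of the binary expansions of `u` and `v`; its rows form a
Hadamard matrix of order 16. -/
def bitInner (u v : Fin 16) : Bool :=
  xor (xor (Nat.testBit (u.val &&& v.val) 0) (Nat.testBit (u.val &&& v.val) 1))
    (xor (Nat.testBit (u.val &&& v.val) 2) (Nat.testBit (u.val &&& v.val) 3))

lemma hammingDist_bitInner {u v : Fin 16} (h : u ≠ v) :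
    hammingDist (bitInner u) (bitInner v) = 8 := by
  revert u v
  decide +kernel

/-- A row of the Hadamard matrix with its columns permuted. -/
def hadamardRow (π : Equiv.Perm (Fin 16)) (u : Fin 16) : Fin 16 → Bool := fun i => bitInner u (π i)

lemma hammingDist_bxor_hadamardRow (π : Equiv.Perm (Fin 16)) (x : Fin 16 → Bool) {u v : Fin 16}
    (h : u ≠ v) : hammingDist (bxor x (hadamardRow π u)) (bxor x (hadamardRow π v)) = 8 := by
  rw [← hammingDist_bitInner h]
  unfold hammingDist
  refine Finset.card_equiv π fun i => ?_
  simp [bxor, hadamardRow]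

/-- On row `u` the value is (-1)^(u · s), with s the sum of `T` in F_2^4, so `T` must sum to zero.
Two distinct elements never do; since all 16 sum to zero, neither do 14. -/
lemma exists_card_walsh_bitInner (n : ℕ) (hn : n ≤ 16) (h2 : n ≠ 2) (h14 : n ≠ 14) :
    ∃ T : Finset (Fin 16), T.card = n ∧ ∀ u, walsh T (bitInner u) = 1 := by
  interval_cases n
  · exact ⟨∅, by decide +kernel⟩
  · exact ⟨{0}, by decide +kernel⟩
  · exact absurd rfl h2
  · exact ⟨{1, 2, 3}, by decide +kernel⟩
  · exact ⟨{0, 1, 2, 3}, by decide +kernel⟩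
  · exact ⟨{1, 2, 4, 8, 15}, by decide +kernel⟩
  · exact ⟨{0, 1, 2, 4, 8, 15}, by decide +kernel⟩
  · exact ⟨{1, 2, 3, 4, 5, 6, 7}, by decide +kernel⟩
  · exact ⟨{0, 1, 2, 3, 4, 5, 6, 7}, by decide +kernel⟩
  · exact ⟨{0, 1, 2, 3, 4, 5, 6, 7}ᶜ ∪ {0}, by decide +kernel⟩
  · exact ⟨{0, 1, 2, 4, 8, 15}ᶜ, by decide +kernel⟩
  · exact ⟨{1, 2, 4, 8, 15}ᶜ, by decide +kernel⟩
  · exact ⟨{0, 1, 2, 3}ᶜ, by decide +kernel⟩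
  · exact ⟨{1, 2, 3}ᶜ, by decide +kernel⟩
  · exact absurd rfl h14
  · exact ⟨{0}ᶜ, by decide +kernel⟩
  · exact ⟨Finset.univ, by decide +kernel⟩

lemma exists_perm_walsh_hadamardRow (S : Finset (Fin 16)) (h2 : S.card ≠ 2) (h14 : S.card ≠ 14) :
    ∃ π : Equiv.Perm (Fin 16), ∀ u, walsh S (hadamardRow π u) = 1 := by
  obtain ⟨T, hT, hw⟩ := exists_card_walsh_bitInner S.card (Finset.card_le_univ S) h2 h14
  let e : {i // i ∈ S} ≃ {i // i ∈ T} := Finset.equivOfCardEq hT.symm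
  refine ⟨e.extendSubtype, fun u => ?_⟩
  rw [← hw u]
  refine Finset.prod_equiv e.extendSubtype (fun i => ?_) fun i _ => rfl
  refine ⟨fun hi => e.extendSubtype_mem i hi, fun hi => ?_⟩
  by_contra hc
  exact e.extendSubtype_not_mem i hc hi

/-- The indicator function of a colour class. -/
def colorIndic (c : (halfDistGraph 16).Coloring (Fin 16)) (x : Fin 16 → Bool) : ℤ :=
  if c x = 0 then 1 else 0

variable (c : (halfDistGraph 16).Coloring (Fin 16))

lemma sum_colorIndic_hadamardRow (π : Equiv.Perm (Fin 16)) (x : Fin 16 → Bool) :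
    ∑ u, colorIndic c (bxor x (hadamardRow π u)) = 1 := by
  have hinj : Function.Injective fun u => c (bxor x (hadamardRow π u)) := by
    intro u v huv
    by_contra h
    refine c.valid ?_ huv
    change 2 * hammingDist _ _ = 16
    rw [hammingDist_bxor_hadamardRow π x h]
  have := Equiv.sum_comp (Equiv.ofBijective _ (Finite.injective_iff_bijective.mp hinj))
    fun a : Fin 16 => if a = 0 then (1 : ℤ) else 0
  simpa [colorIndic] using this

lemma walshCoeff_colorIndic_empty : walshCoeff (colorIndic c) ∅ = 4096 := by
  have h := card_mul_walshCoeff (colorIndic c) _ (sum_colorIndic_hadamardRow c (Equiv.refl _)) ∅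
    fun _ => walsh_empty _
  simp at h
  linarith

lemma walshCoeff_colorIndic_eq_zero {S : Finset (Fin 16)} (h0 : S.card ≠ 0) (h2 : S.card ≠ 2)
    (h14 : S.card ≠ 14) : walshCoeff (colorIndic c) S = 0 := by
  obtain ⟨π, hπ⟩ := exists_perm_walsh_hadamardRow S h2 h14
  have h := card_mul_walshCoeff (colorIndic c) _ (sum_colorIndic_hadamardRow c π) S hπ
  rw [sum_walsh_of_nonempty (Finset.card_ne_zero.mp h0)] at h
  simpa using h

end Clique

/-! ### Arithmetic of the pair coefficients -/

lemma sum_eq_empty_add_sum_pairs (g : Finset (Fin 16) → ℤ)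
    (hg : ∀ S : Finset (Fin 16), S.card ≠ 0 → S.card ≠ 2 → S.card ≠ 14 → g S = 0) :
    ∑ S, g S = g ∅ + ∑ T ∈ Finset.powersetCard 2 Finset.univ, (g T + g Tᶜ) := by
  have hc : ∑ T ∈ Finset.powersetCard 2 Finset.univ, g Tᶜ
      = ∑ T ∈ Finset.powersetCard 14 Finset.univ, g T := by
    refine Finset.sum_nbij' (fun T => Tᶜ) (fun T => Tᶜ) ?_ ?_ ?_ ?_ ?_ <;>
      simp +contextual [Finset.mem_powersetCard, Finset.card_compl]
  have hz : ∀ n, n ≠ 0 → n ≠ 2 → n ≠ 14 →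
      ∑ T ∈ Finset.powersetCard n (Finset.univ : Finset (Fin 16)), g T = 0 := by
    intro n h0 h2 h14
    refine Finset.sum_eq_zero fun T hT => ?_
    obtain rfl := (Finset.mem_powersetCard.mp hT).2
    exact hg T h0 h2 h14
  rw [Finset.sum_add_distrib, hc, ← Finset.powerset_univ, Finset.sum_powerset, Finset.card_univ,
    Fintype.card_fin]
  simp only [Finset.sum_range_succ, Finset.sum_range_zero]
  rw [hz 1, hz 3, hz 4, hz 5, hz 6, hz 7, hz 8, hz 9, hz 10, hz 11, hz 12, hz 13, hz 15, hz 16]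
  · simp [add_assoc]
  all_goals decide

/-- The Walsh functions of a set and of its complement coincide on vectors of even weight; this is
their joint coefficient. -/
def pairCoeff (f : (Fin 16 → Bool) → ℤ) (T : Finset (Fin 16)) : ℤ :=
  walshCoeff f T + walshCoeff f Tᶜ

/-- A combination of Walsh values that isolates the sets meeting `{i, j, k, l}` in `{i, k}` or in
`{j, l}`. -/
def pairSelector (i j k l : Fin 16) (S : Finset (Fin 16)) : ℤ :=
  (1 - walsh S (indic {i, j})) * (1 - walsh S (indic {k, l})) * (1 + walsh S (indic {i, k}))

lemma pairSelector_compl {i j k l : Fin 16} (hij : i ≠ j) (hkl : k ≠ l) (hik : i ≠ k)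
    (S : Finset (Fin 16)) : pairSelector i j k l Sᶜ = pairSelector i j k l S := by
  have hpair : ∀ a b : Fin 16, a ≠ b → walsh Sᶜ (indic {a, b}) = walsh S (indic {a, b}) :=
    fun a b hab => walsh_compl_of_univ (by simp [walsh_indic_pair _ hab]) S
  simp only [pairSelector, hpair i j hij, hpair k l hkl, hpair i k hik]

/-- Expanding the selector turns the sum into 2^16 times a signed sum of eight values of `f`. -/
lemma dvd_sum_pairSelector (f : (Fin 16 → Bool) → ℤ) (x : Fin 16 → Bool) (i j k l : Fin 16) :
    2 ^ 16 ∣ ∑ S, walshCoeff f S * walsh S x * pairSelector i j k l S := by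
  generalize hu : (indic {i, j} : Fin 16 → Bool) = u
  generalize hv : (indic {k, l} : Fin 16 → Bool) = v
  generalize hw : (indic {i, k} : Fin 16 → Bool) = w
  have h16 : (2 : ℤ) ^ 16 = 2 ^ Fintype.card (Fin 16) := by rw [Fintype.card_fin]
  refine ⟨f x - f (bxor x u) - f (bxor x v) + f (bxor (bxor x u) v)
    + f (bxor x w) - f (bxor (bxor x w) u) - f (bxor (bxor x w) v)
    + f (bxor (bxor (bxor x w) u) v), ?_⟩
  rw [h16]
  simp only [mul_add, mul_sub, ← sum_walshCoeff_mul_walsh, ← Finset.sum_add_distrib,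
    ← Finset.sum_sub_distrib, walsh_bxor, pairSelector, hu, hv, hw]
  exact Finset.sum_congr rfl fun S _ => by ring

lemma walshCoeff_eq_zero_of_separates {f : (Fin 16 → Bool) → ℤ}
    (hf : ∀ S : Finset (Fin 16), S.card ≠ 0 → S.card ≠ 2 → S.card ≠ 14 → walshCoeff f S = 0)
    {S : Finset (Fin 16)} {a b p q : Fin 16} (hab : a ≠ b) (hpq : p ≠ q) (ha : a ∈ S) (hb : b ∈ S)
    (hp : p ∉ S) (hq : q ∉ S) (hS1 : S ≠ {a, b}) (hS2 : S ≠ {p, q}ᶜ) : walshCoeff f S = 0 := by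
  have hsub : {a, b} ⊆ S := by simp [Finset.insert_subset_iff, ha, hb]
  have hsub' : S ⊆ {p, q}ᶜ := by
    intro t ht
    simp only [Finset.mem_compl, Finset.mem_insert, Finset.mem_singleton]
    rintro (rfl | rfl) <;> contradiction
  have hc' : ({p, q}ᶜ : Finset (Fin 16)).card = 14 := by
    rw [Finset.card_compl, Finset.card_pair hpq, Fintype.card_fin]
  apply hf
  · exact Finset.card_ne_zero_of_mem ha
  · intro h
    exact hS1 (Finset.eq_of_subset_of_card_le hsub (by rw [h, Finset.card_pair hab])).symm
  · intro h
    exact hS2 (Finset.eq_of_subset_of_card_le hsub' (by rw [h, hc']))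

lemma walshCoeff_mul_pairSelector_eq_zero {f : (Fin 16 → Bool) → ℤ}
    (hf : ∀ S : Finset (Fin 16), S.card ≠ 0 → S.card ≠ 2 → S.card ≠ 14 → walshCoeff f S = 0)
    {i j k l : Fin 16} (hij : i ≠ j) (hkl : k ≠ l) (hik : i ≠ k) (hjl : j ≠ l)
    {S : Finset (Fin 16)} (h1 : S ≠ {i, k}) (h2 : S ≠ {j, l}) (h3 : S ≠ {i, k}ᶜ)
    (h4 : S ≠ {j, l}ᶜ) : walshCoeff f S * pairSelector i j k l S = 0 := by
  simp only [pairSelector, walsh_indic_pair S hij, walsh_indic_pair S hkl, walsh_indic_pair S hik]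
  by_cases hi : i ∈ S <;> by_cases hj : j ∈ S <;> by_cases hk : k ∈ S <;>
    by_cases hl : l ∈ S <;> simp only [hi, hj, hk, hl, if_true, if_false] <;> norm_num
  -- Only the two patterns where the selector is nonzero remain.
  · exact walshCoeff_eq_zero_of_separates hf hik hjl hi hk hj hl h1 h4
  · exact walshCoeff_eq_zero_of_separates hf hjl hik hj hl hi hk h2 h3

/-- The selector is 8 on each of the four surviving sets, so 2^16 drops to 2^13. -/
lemma dvd_pairCoeff_add {f : (Fin 16 → Bool) → ℤ}
    (hf : ∀ S : Finset (Fin 16), S.card ≠ 0 → S.card ≠ 2 → S.card ≠ 14 → walshCoeff f S = 0)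
    {x : Fin 16 → Bool} (hx : walsh Finset.univ x = 1) {i j k l : Fin 16}
    (hd : [i, j, k, l].Nodup) :
    2 ^ 13 ∣ pairCoeff f {i, k} * walsh {i, k} x + pairCoeff f {j, l} * walsh {j, l} x := by
  simp only [List.nodup_cons, List.mem_cons, List.not_mem_nil, or_false, not_or, not_false_eq_true,
    List.nodup_nil, and_true, ← ne_eq] at hd
  obtain ⟨⟨hij, hik, hil⟩, ⟨hjk, hjl⟩, hkl⟩ := hd
  obtain ⟨m, key⟩ := dvd_sum_pairSelector f x i j k l
  have hik2 : ({i, k} : Finset (Fin 16)).card = 2 := Finset.card_pair hik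
  have hjl2 : ({j, l} : Finset (Fin 16)).card = 2 := Finset.card_pair hjl
  have hε1 : pairSelector i j k l {i, k} = 8 := by
    simp [pairSelector, walsh_indic_pair _ hij, walsh_indic_pair _ hkl, walsh_indic_pair _ hik,
      hij.symm, hjk, hil.symm, hkl.symm]
  have hε2 : pairSelector i j k l {j, l} = 8 := by
    simp [pairSelector, walsh_indic_pair _ hij, walsh_indic_pair _ hkl, walsh_indic_pair _ hik,
      hij, hil, hkl, hjk.symm]
  have hne : ∀ S T : Finset (Fin 16), S.card = 2 → T.card = 2 → S ≠ Tᶜ := by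
    rintro S T hS hT rfl
    rw [Finset.card_compl, hT, Fintype.card_fin] at hS
    omega
  have hne' : ({i, k} : Finset (Fin 16)) ≠ {j, l} := by
    intro h
    have : i ∈ ({j, l} : Finset (Fin 16)) := h ▸ Finset.mem_insert_self i {k}
    simp [hij, hil] at this
  rw [← Finset.sum_subset (Finset.subset_univ ({{i, k}, {j, l}, {i, k}ᶜ, {j, l}ᶜ} : Finset _))
    fun S _ hS => by
      simp only [Finset.mem_insert, Finset.mem_singleton, not_or] at hS
      rw [mul_right_comm, walshCoeff_mul_pairSelector_eq_zero hf hij hkl hik hjl hS.1 hS.2.1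
        hS.2.2.1 hS.2.2.2, zero_mul]] at key
  rw [Finset.sum_insert (by simp only [Finset.mem_insert, Finset.mem_singleton, not_or]
                            exact ⟨hne', hne _ _ hik2 hik2, hne _ _ hik2 hjl2⟩),
    Finset.sum_insert (by simp only [Finset.mem_insert, Finset.mem_singleton, not_or]
                          exact ⟨hne _ _ hjl2 hik2, hne _ _ hjl2 hjl2⟩),
    Finset.sum_insert (by simpa only [Finset.mem_singleton, compl_inj_iff] using hne'),
    Finset.sum_singleton] at key
  simp only [pairSelector_compl hij hkl hik, hε1, hε2, walsh_compl_of_univ hx] at key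
  refine ⟨m, ?_⟩
  simp only [pairCoeff]
  linarith

lemma dvd_pairCoeff_and_iff {f : (Fin 16 → Bool) → ℤ}
    (hf : ∀ S : Finset (Fin 16), S.card ≠ 0 → S.card ≠ 2 → S.card ≠ 14 → walshCoeff f S = 0)
    {i j k l : Fin 16} (hd : [i, j, k, l].Nodup) :
    4096 ∣ pairCoeff f {i, k} ∧
      ((8192 : ℤ) ∣ pairCoeff f {i, k} ↔ (8192 : ℤ) ∣ pairCoeff f {j, l}) := by
  have h1 := dvd_pairCoeff_add hf (walsh_zero _) hd
  obtain ⟨t, ht⟩ : ∃ t, t ∉ ({i, j, k, l} : Finset (Fin 16)) := by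
    by_contra! h
    have := (Finset.card_le_card (fun t _ => h t : Finset.univ ⊆ _)).trans Finset.card_le_four
    simp at this
  simp only [Finset.mem_insert, Finset.mem_singleton, not_or] at ht
  obtain ⟨hti, htj, htk, htl⟩ := ht
  -- Flipping `i` and an outside `t` keeps the weight even but changes the sign of the `{i, k}` term
  -- only. So 8192 divides both the sum and the difference of the two coefficients.
  have h2 := dvd_pairCoeff_add hf (x := indic {i, t})
    (by simp [walsh_indic_pair _ (Ne.symm hti)]) hd
  simp only [List.nodup_cons, List.mem_cons, List.not_mem_nil, or_false, not_or, not_false_eq_true,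
    List.nodup_nil, and_true] at hd
  obtain ⟨⟨hij, hik, hil⟩, ⟨hjk, hjl⟩, hkl⟩ := hd
  simp [walsh_indic_pair _ (Ne.symm hti), hij, hil, hti, htj, htk, htl] at h1 h2
  omega

lemma dvd_pairCoeff_iff {f : (Fin 16 → Bool) → ℤ}
    (hf : ∀ S : Finset (Fin 16), S.card ≠ 0 → S.card ≠ 2 → S.card ≠ 14 → walshCoeff f S = 0)
    {T : Finset (Fin 16)} (hT : T.card = 2) :
    4096 ∣ pairCoeff f T ∧
      ((8192 : ℤ) ∣ pairCoeff f T ↔ (8192 : ℤ) ∣ pairCoeff f {0, 1}) := by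
  obtain ⟨a, b, hab, rfl⟩ := Finset.card_eq_two.mp hT
  have hcard : 1 < (({a, b} ∪ {0, 1} : Finset (Fin 16))ᶜ).card := by
    have h := Finset.card_union_le ({a, b} : Finset (Fin 16)) {0, 1}
    rw [Finset.card_pair hab, Finset.card_pair (by decide)] at h
    rw [Finset.card_compl, Fintype.card_fin]
    omega
  -- A pair disjoint from both links `{a, b}` to `{0, 1}`, which may overlap.
  obtain ⟨p, hp, q, hq, hpq⟩ := Finset.one_lt_card.mp hcard
  simp only [Finset.mem_compl, Finset.mem_union, Finset.mem_insert, Finset.mem_singleton,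
    not_or] at hp hq
  have h1 := dvd_pairCoeff_and_iff hf (i := a) (j := p) (k := b) (l := q) (by simp; grind)
  have h2 := dvd_pairCoeff_and_iff hf (i := 0) (j := p) (k := 1) (l := q) (by simp; grind)
  exact ⟨h1.1, h1.2.trans h2.2.symm⟩

theorem proposition2 : 16 < (halfDistGraph 16).chromaticNumber := by
  by_contra! h
  obtain ⟨c⟩ := SimpleGraph.chromaticNumber_le_iff_colorable.mp h
  set f := colorIndic c with hfdef
  have hf : ∀ S : Finset (Fin 16), S.card ≠ 0 → S.card ≠ 2 → S.card ≠ 14 →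
      walshCoeff f S = 0 := fun S => walshCoeff_colorIndic_eq_zero c
  have h0 : walshCoeff f ∅ = 4096 := walshCoeff_colorIndic_empty c
  by_cases hdvd : (8192 : ℤ) ∣ pairCoeff f {0, 1}
  · have hinv := sum_walshCoeff_mul_walsh f fun _ => false
    simp only [walsh_zero, mul_one] at hinv
    rw [sum_eq_empty_add_sum_pairs _ hf, h0, Fintype.card_fin] at hinv
    have hsum : (8192 : ℤ) ∣ ∑ T ∈ Finset.powersetCard 2 Finset.univ,
        (walshCoeff f T + walshCoeff f Tᶜ) :=
      Finset.dvd_sum fun T hT =>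
        (dvd_pairCoeff_iff hf (Finset.mem_powersetCard.mp hT).2).2.mpr hdvd
    -- Modulo 8192 inversion at zero reads 0 = 4096.
    omega
  · have hpar := sum_walshCoeff_sq f
    have hsq : ∑ x, f x ^ 2 = 4096 := by
      rw [← h0, walshCoeff]
      refine Finset.sum_congr rfl fun x _ => ?_
      simp only [hfdef, colorIndic, walsh_empty]
      split_ifs <;> rfl
    rw [hsq, sum_eq_empty_add_sum_pairs _ fun S a b d => by rw [hf S a b d]; rfl, h0,
      Fintype.card_fin] at hpar
    -- From a² + b² ≥ (a + b)²/2 with |a + b| ≥ 2^12. The 120 pairs give 120 · 2^23, above the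
    -- Parseval total 2^28 = 32 · 2^23.
    have hle : ∑ T ∈ Finset.powersetCard 2 (Finset.univ : Finset (Fin 16)), (2 ^ 23 : ℤ)
        ≤ ∑ T ∈ Finset.powersetCard 2 Finset.univ,
          (walshCoeff f T ^ 2 + walshCoeff f Tᶜ ^ 2) := by
      refine Finset.sum_le_sum fun T hT => ?_
      obtain ⟨⟨e, he⟩, hiff⟩ := dvd_pairCoeff_iff hf (Finset.mem_powersetCard.mp hT).2
      have he0 : e ≠ 0 := by
        rintro rfl
        exact hdvd (hiff.mp (by rw [he]; simp))
      have he1 : 1 ≤ e ^ 2 := Int.add_one_le_iff.mpr (sq_pos_of_ne_zero he0)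
      unfold pairCoeff at he
      have hs : (walshCoeff f T + walshCoeff f Tᶜ) ^ 2 = 2 ^ 24 * e ^ 2 := by rw [he]; ring
      nlinarith [sq_nonneg (walshCoeff f T - walshCoeff f Tᶜ)]
    rw [Finset.sum_const, Finset.card_powersetCard, Finset.card_univ, Fintype.card_fin,
      show Nat.choose 16 2 = 120 from rfl] at hle
    norm_num at hle hpar
    linarith
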